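/- For each $N\in\mathbb{N}$ let $\mathbf{H}=\mathbf{H}_N$ and $\mathbf{E}=\mathbf{E}_N$ be real $L\times K$ matrices, where $L=L(N)$ and $K=K(N)$, such that for all sufficiently large $N$ both are non-zero and $d=\operatorname{rank}\mathbf{H}<\min(L,K)$. Let $\|\cdot\|$ be the spectral norm, let $\mu_{\max}$ and $\mu_{\min}$ be the largest and the smallest positive eigenvalues of $\mathbf{H}\mathbf{H}^{\mathrm T}$, let $\nu_{\max}=\|\mathbf{E}\mathbf{E}^{\mathrm T}\|$, and put $$\Theta=\Theta_N=\sqrt{\frac{\nu_{\max}}{\mu_{\max}}}\;\frac{\mu_{\max}}{\mu_{\min}}.$$ Let $\mathbf{P}_0$ be the orthogonal projector of $\mathbb{R}^L$ onto the kernel of $\mathbf{H}\mathbf{H}^{\mathrm T}$, $\mathbf{P}_0^\perp=\mathbf{I}-\mathbf{P}_0$, let $\mathbf{S}_0$ be the pseudoinverse of $\mathbf{H}\mathbf{H}^{\mathrm T}$, and $$\mathbf{V}_0^{(1)}=\mathbf{P}_0\mathbf{A}^{(1)}\mathbf{S}_0+\mathbf{S}_0\mathbf{A}^{(1)}\mathbf{P}_0,\qquad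 \mathbf{A}^{(1)}=\mathbf{H}\mathbf{E}^{\mathrm T}+\mathbf{E}\mathbf{H}^{\mathrm T}.$$ For $\delta\in\mathbb{R}$ let $\mathbf{P}_0^\perp(\delta)$ be the orthogonal projector onto the span of $d$ leading left singular vectors of $\mathbf{H}(\delta)=\mathbf{H}+\delta\mathbf{E}$, that is, of $d$ orthonormal eigenvectors of $\mathbf{H}(\delta)\mathbf{H}(\delta)^{\mathrm T}$ belonging to its $d$ largest eigenvalues counted with multiplicity (any choice of them, if the span is not unique). If $\Theta\to 0$ as $N\to\infty$, then for every $\delta\in\mathbb{R}$ $$\limsup_{N\to\infty}\,\Theta^{-1}\,\big\|\mathbf{P}_0^\perp(\delta)-\mathbf{P}_0^\perp\big\|\le 8C|\delta|$$ and $$\limsup_{N\to\infty}\,\Theta^{-2}\,\big\|\mathbf{P}_0^\perp(\delta)-\mathbf{P}_0^\perp-\delta\mathbf{V}_0^{(1)}\big\|\le C'\delta^2,$$ where $C=e^{1/6}/\sqrt{\pi}$ and $C'=2(32C+1)$. -/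

import Mathlib

open Filter Topology
-- the norm of a matrix is its spectral (operator) norm
open scoped Matrix.Norms.L2Operator

noncomputable section

namespace SignalSubspace

variable {L K : ℕ}

/-- The matrix, in the standard basis of `ℝ^L`, of the orthogonal projector onto a subspace. -/
def projMatrix (U : Submodule ℝ (EuclideanSpace ℝ (Fin L))) : Matrix (Fin L) (Fin L) ℝ :=
  (Matrix.toEuclideanCLM (n := Fin L) (𝕜 := ℝ)).symm U.starProjection

/-- The matrix `A = H Hᵀ`. -/
def gram (H : Matrix (Fin L) (Fin K) ℝ) : Matrix (Fin L) (Fin L) ℝ :=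
  H * H.transpose

theorem gram_isHermitian (H : Matrix (Fin L) (Fin K) ℝ) : (gram H).IsHermitian :=
  Matrix.isHermitian_mul_conjTranspose_self H

/-- The set of eigenvalues of a square matrix acting on `ℝ^L`. -/
def eigenvalueSet (A : Matrix (Fin L) (Fin L) ℝ) : Set ℝ :=
  {μ | Module.End.HasEigenvalue (Matrix.toEuclideanLin A) μ}

/-- The smallest positive eigenvalue of `H Hᵀ`. -/
def muMin (H : Matrix (Fin L) (Fin K) ℝ) : ℝ :=
  sInf {μ | μ ∈ eigenvalueSet (gram H) ∧ 0 < μ}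

/-- The largest eigenvalue of `H Hᵀ`. -/
def muMax (H : Matrix (Fin L) (Fin K) ℝ) : ℝ :=
  sSup (eigenvalueSet (gram H))

/-- `ν_max`, the spectral norm of `E Eᵀ`. -/
def nuMax (E : Matrix (Fin L) (Fin K) ℝ) : ℝ :=
  ‖gram E‖

/-- `Θ = √(ν_max / μ_max) * (μ_max / μ_min)`. -/
def Theta (H E : Matrix (Fin L) (Fin K) ℝ) : ℝ :=
  √(nuMax E / muMax H) * (muMax H / muMin H)

/-- The orthogonal projector `P₀` onto the eigenspace of `H Hᵀ` for the eigenvalue zero. -/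
def kerProj (H : Matrix (Fin L) (Fin K) ℝ) : Matrix (Fin L) (Fin L) ℝ :=
  projMatrix (Module.End.eigenspace (Matrix.toEuclideanLin (gram H)) 0)

/-- The projector `P₀^⊥ = I - P₀` onto the signal subspace. -/
def signalProj (H : Matrix (Fin L) (Fin K) ℝ) : Matrix (Fin L) (Fin L) ℝ :=
  1 - kerProj H

/-- `S` is the Moore-Penrose pseudoinverse of `A` (the four Penrose equations). -/
structure IsMoorePenrose (A S : Matrix (Fin L) (Fin L) ℝ) : Prop where
  mul_mul_self : A * S * A = A
  self_mul_mul : S * A * S = S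
  left_symm : (A * S).transpose = A * S
  right_symm : (S * A).transpose = S * A

/-- The pseudoinverse `S₀` of `H Hᵀ`: in an orthonormal eigenbasis of `H Hᵀ`, it inverts the
positive eigenvalues and keeps the zero ones (`0⁻¹ = 0`). -/
def gramPinv (H : Matrix (Fin L) (Fin K) ℝ) : Matrix (Fin L) (Fin L) ℝ :=
  (gram_isHermitian H).cfc (fun x => x⁻¹)

/-- `V₀^{(1)} = P₀ A^{(1)} S₀ + S₀ A^{(1)} P₀` with `A^{(1)} = H Eᵀ + E Hᵀ`. -/
def linTerm (H E : Matrix (Fin L) (Fin K) ℝ) : Matrix (Fin L) (Fin L) ℝ :=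
  kerProj H * (H * E.transpose + E * H.transpose) * gramPinv H
    + gramPinv H * (H * E.transpose + E * H.transpose) * kerProj H

/-- `P` is an orthogonal projector onto the span of `d` leading eigenvectors of the symmetric
matrix `A`: for some orthonormal basis of eigenvectors, listed with eigenvalues in nonincreasing
order, `P` projects onto the span of the first `d` of them. -/
def IsLeadingProj (A : Matrix (Fin L) (Fin L) ℝ) (d : ℕ) (P : Matrix (Fin L) (Fin L) ℝ) : Prop :=
  ∃ (b : OrthonormalBasis (Fin L) ℝ (EuclideanSpace ℝ (Fin L))) (ev : Fin L → ℝ),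
    Antitone ev ∧ (∀ i, Matrix.toEuclideanLin A (b i) = ev i • b i) ∧
    P = projMatrix (Submodule.span ℝ (b '' {i | (i : ℕ) < d}))

/-- `P` is a perturbed projector `P₀^⊥(δ)`: it projects onto the span of `d = rank H` leading
eigenvectors of `H(δ) H(δ)ᵀ` (leading left singular vectors of `H(δ)`), `H(δ) = H + δ E`. -/
def IsPerturbedProj (H E : Matrix (Fin L) (Fin K) ℝ) (δ : ℝ)
    (P : Matrix (Fin L) (Fin L) ℝ) : Prop :=
  IsLeadingProj (gram (H + δ • E)) H.rank P

theorem gramPinv_isMoorePenrose (H : Matrix (Fin L) (Fin K) ℝ) :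
    IsMoorePenrose (gram H) (gramPinv H) := by
  have h := gram_isHermitian H
  have hA : gram H = cfc (fun x : ℝ => x) (gram H) := (cfc_id' ℝ (gram H)).symm
  have hS : gramPinv H = cfc (fun x : ℝ => x⁻¹) (gram H) := (h.cfc_eq _).symm
  have hc : ∀ f : ℝ → ℝ, ContinuousOn f (spectrum ℝ (gram H)) := fun f =>
    (Matrix.finite_real_spectrum (A := gram H)).continuousOn f
  have hAS : gram H * gramPinv H = cfc (fun x : ℝ => x * x⁻¹) (gram H) := by
    rw [hS]; nth_rw 1 [hA]; exact (cfc_mul _ _ _ (hc _) (hc _)).symm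
  have hSA : gramPinv H * gram H = cfc (fun x : ℝ => x⁻¹ * x) (gram H) := by
    rw [hS]; nth_rw 2 [hA]; exact (cfc_mul _ _ _ (hc _) (hc _)).symm
  have hsym : ∀ f : ℝ → ℝ, (cfc f (gram H)).transpose = cfc f (gram H) := fun f =>
    (cfc_predicate f (gram H) : IsSelfAdjoint _)
  refine ⟨?_, ?_, ?_, ?_⟩
  · rw [hAS]; nth_rw 2 [hA]; rw [← cfc_mul _ _ _ (hc _) (hc _)]
    conv_rhs => rw [hA]
    congr 1; funext x; simp
  · rw [hSA]; rw [hS, ← cfc_mul _ _ _ (hc _) (hc _)]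
    congr 1; funext x
    by_cases hx : x = 0 <;> simp [hx]
  · rw [hAS]; exact hsym _
  · rw [hSA]; exact hsym _

theorem exists_isPerturbedProj (H E : Matrix (Fin L) (Fin K) ℝ) (δ : ℝ) :
    ∃ P, IsPerturbedProj H E δ P := by
  have h := gram_isHermitian (H + δ • E)
  have hs := Matrix.isSymmetric_toEuclideanLin_iff.mpr h
  have hn : Module.finrank ℝ (EuclideanSpace ℝ (Fin L)) = L := by simp
  exact ⟨_, hs.eigenvectorBasis hn, hs.eigenvalues hn, hs.eigenvalues_antitone hn,
    fun i => hs.apply_eigenvectorBasis hn i, rfl⟩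

end SignalSubspace

end

/-! Write A = HHᵀ, m = μ_min, Q for the signal projector, S for the pseudoinverse of A, and
H(δ)H(δ)ᵀ = A + B with B = W + G, W = δA⁽¹⁾, G = δ²EEᵀ. The definition of Θ gives ‖E‖‖H‖ ≤ Θm and
‖E‖² ≤ Θ²m, so with t = |δ|Θ ≤ 1/20 one has ‖B‖ ≤ β = (41/20)tm, far below the spectral gap m of A.

By Weyl's inequality the d leading eigenvalues of A + B are at least m − β and the others at most β.
As P commutes with A + B, and A(1 − Q) = 0, AS = Q, both P(1 − Q) and (1 − P)Q have norm at most
β/(m − β) ≤ (5/2)t (`IsPerturbedProj.angle_le`). Their difference is P − Q, whence ‖P − Q‖ ≤ 5t.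

For the second order, split P − Q into blocks along Q and 1 − Q. The diagonal blocks are products of
two such small factors. The block (1 − Q)PQ equals (1 − Q)WS up to O(t²), by the commutation
relation multiplied by S (`norm_sub_sub_le`). The total is 35t². Both bounds hold for each N with t
≤ 1/20, without passing to the limit, and 5 ≤ 8C, 35 ≤ 2(32C + 1). -/

noncomputable section

namespace SignalSubspace

/-! ### Quadratic forms and norms in an orthonormal eigenbasis -/

section Eigenbasis

variable {V ι : Type*} [NormedAddCommGroup V] [InnerProductSpace ℝ V] [Fintype ι]

theorem inner_apply_of_eigenbasis (b : OrthonormalBasis ι ℝ V) {T : V →ₗ[ℝ] V} {ev : ι → ℝ}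
    (hT : ∀ i, T (b i) = ev i • b i) (i : ι) (v : V) :
    inner ℝ (b i) (T v) = ev i * inner ℝ (b i) v := by
  classical
  conv_lhs => rw [← b.sum_repr' v]
  simp only [map_sum, map_smul, hT, inner_sum, inner_smul_right]
  rw [Finset.sum_eq_single i]
  · rw [real_inner_self_eq_norm_sq, b.norm_eq_one]; ring
  · intro j _ hj
    rw [b.inner_eq_ite, if_neg (Ne.symm hj)]; simp
  · simp

theorem norm_sq_eq_sum_inner_sq (b : OrthonormalBasis ι ℝ V) (v : V) :
    ‖v‖ ^ 2 = ∑ i, inner ℝ (b i) v ^ 2 := by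
  rw [← b.sum_sq_norm_inner_right v]
  simp

theorem inner_apply_eq_sum (b : OrthonormalBasis ι ℝ V) {T : V →ₗ[ℝ] V} {ev : ι → ℝ}
    (hT : ∀ i, T (b i) = ev i • b i) (v : V) :
    inner ℝ v (T v) = ∑ i, ev i * inner ℝ (b i) v ^ 2 := by
  rw [← b.sum_inner_mul_inner]
  refine Finset.sum_congr rfl fun i _ => ?_
  rw [inner_apply_of_eigenbasis b hT, real_inner_comm]; ring

theorem norm_apply_sq_eq_sum (b : OrthonormalBasis ι ℝ V) {T : V →ₗ[ℝ] V} {ev : ι → ℝ}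
    (hT : ∀ i, T (b i) = ev i • b i) (v : V) :
    ‖T v‖ ^ 2 = ∑ i, ev i ^ 2 * inner ℝ (b i) v ^ 2 := by
  rw [norm_sq_eq_sum_inner_sq b]
  refine Finset.sum_congr rfl fun i _ => ?_
  rw [inner_apply_of_eigenbasis b hT]; ring

/-- Only coordinates along which `v` is nonzero are constrained, so the bound applies on a span of
selected eigenvectors without restricting the operator. -/
theorem le_inner_apply_of_eigenbasis (b : OrthonormalBasis ι ℝ V) {T : V →ₗ[ℝ] V} {ev : ι → ℝ}
    (hT : ∀ i, T (b i) = ev i • b i) {c : ℝ} {v : V}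
    (h : ∀ i, inner ℝ (b i) v ≠ 0 → c ≤ ev i) : c * ‖v‖ ^ 2 ≤ inner ℝ v (T v) := by
  rw [inner_apply_eq_sum b hT, norm_sq_eq_sum_inner_sq b, Finset.mul_sum]
  refine Finset.sum_le_sum fun i _ => ?_
  by_cases hi : inner ℝ (b i) v = 0
  · simp [hi]
  · exact mul_le_mul_of_nonneg_right (h i hi) (sq_nonneg _)

theorem inner_apply_le_of_eigenbasis (b : OrthonormalBasis ι ℝ V) {T : V →ₗ[ℝ] V} {ev : ι → ℝ}
    (hT : ∀ i, T (b i) = ev i • b i) {c : ℝ} {v : V}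
    (h : ∀ i, inner ℝ (b i) v ≠ 0 → ev i ≤ c) : inner ℝ v (T v) ≤ c * ‖v‖ ^ 2 := by
  rw [inner_apply_eq_sum b hT, norm_sq_eq_sum_inner_sq b, Finset.mul_sum]
  refine Finset.sum_le_sum fun i _ => ?_
  by_cases hi : inner ℝ (b i) v = 0
  · simp [hi]
  · exact mul_le_mul_of_nonneg_right (h i hi) (sq_nonneg _)

theorem le_norm_apply_of_eigenbasis (b : OrthonormalBasis ι ℝ V) {T : V →ₗ[ℝ] V} {ev : ι → ℝ}
    (hT : ∀ i, T (b i) = ev i • b i) {c : ℝ} (hc : 0 ≤ c) {v : V}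
    (h : ∀ i, inner ℝ (b i) v ≠ 0 → c ≤ |ev i|) : c * ‖v‖ ≤ ‖T v‖ := by
  refine le_of_sq_le_sq ?_ (norm_nonneg _)
  rw [norm_apply_sq_eq_sum b hT, mul_pow, norm_sq_eq_sum_inner_sq b, Finset.mul_sum]
  refine Finset.sum_le_sum fun i _ => ?_
  by_cases hi : inner ℝ (b i) v = 0
  · simp [hi]
  · refine mul_le_mul_of_nonneg_right ?_ (sq_nonneg _)
    rw [← sq_abs (ev i)]
    exact pow_le_pow_left₀ hc (h i hi) 2

theorem norm_apply_le_of_eigenbasis (b : OrthonormalBasis ι ℝ V) {T : V →ₗ[ℝ] V} {ev : ι → ℝ}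
    (hT : ∀ i, T (b i) = ev i • b i) {c : ℝ} (hc : 0 ≤ c) {v : V}
    (h : ∀ i, inner ℝ (b i) v ≠ 0 → |ev i| ≤ c) : ‖T v‖ ≤ c * ‖v‖ := by
  refine le_of_sq_le_sq ?_ (by positivity)
  rw [norm_apply_sq_eq_sum b hT, mul_pow, norm_sq_eq_sum_inner_sq b, Finset.mul_sum]
  refine Finset.sum_le_sum fun i _ => ?_
  by_cases hi : inner ℝ (b i) v = 0
  · simp [hi]
  · refine mul_le_mul_of_nonneg_right ?_ (sq_nonneg _)
    rw [← sq_abs (ev i)]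
    exact pow_le_pow_left₀ (abs_nonneg _) (h i hi) 2

theorem mem_of_inner_ne_zero (b : OrthonormalBasis ι ℝ V) {s : Set ι} {v : V}
    (hv : v ∈ Submodule.span ℝ (b '' s)) {i : ι} (hi : inner ℝ (b i) v ≠ 0) : i ∈ s := by
  classical
  by_contra his
  refine hi (Submodule.mem_orthogonal_singleton_iff_inner_right.mp
    ((Submodule.span_le (p := (Submodule.span ℝ {b i})ᗮ)).mpr ?_ hv))
  rintro _ ⟨j, hj, rfl⟩
  rw [SetLike.mem_coe, Submodule.mem_orthogonal_singleton_iff_inner_right, b.inner_eq_ite,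
    if_neg (by rintro rfl; exact his hj)]

theorem notMem_of_inner_ne_zero (b : OrthonormalBasis ι ℝ V) {s : Set ι} {v : V}
    (hv : v ∈ (Submodule.span ℝ (b '' s))ᗮ) {i : ι} (hi : inner ℝ (b i) v ≠ 0) : i ∉ s :=
  fun his => hi (hv _ (Submodule.subset_span ⟨i, his, rfl⟩))

theorem finrank_span_image (b : OrthonormalBasis ι ℝ V) (s : Finset ι) :
    Module.finrank ℝ (Submodule.span ℝ (b '' (s : Set ι))) = s.card := by
  have h : LinearIndependent ℝ (fun i : s => b i) :=
    b.orthonormal.linearIndependent.comp _ Subtype.val_injective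
  have h2 := finrank_span_eq_card h
  rw [Fintype.card_coe] at h2
  rw [← h2, Set.image_eq_range]
  rfl

theorem exists_mem_mem_ne_zero [FiniteDimensional ℝ V] {s t : Submodule ℝ V}
    (h : Module.finrank ℝ V < Module.finrank ℝ s + Module.finrank ℝ t) :
    ∃ v ∈ s, v ∈ t ∧ v ≠ 0 := by
  by_contra! hc
  refine absurd (Submodule.finrank_add_finrank_le_of_disjoint (s := s) (t := t) ?_) (not_le.mpr h)
  exact Submodule.disjoint_def.mpr hc

end Eigenbasis

/-! ### Algebraic perturbation estimates for commuting projectors -/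

section NormedRing

variable {R : Type*} [NormedRing R]

/-- First-order bounds for the projector `P` commuting with `A + B` against the projector `Q`
commuting with `A`. -/
theorem norm_mul_compl_le {A B P Q : R} {m β : ℝ} (hAQ : A * Q = A)
    (hcomm : (A + B) * P = P * (A + B)) (nP : ‖P‖ ≤ 1) (nQ' : ‖1 - Q‖ ≤ 1) (hB : ‖B‖ ≤ β)
    (hlow : ∀ M, (m - β) * ‖P * M‖ ≤ ‖(A + B) * (P * M)‖) :
    (m - β) * ‖P * (1 - Q)‖ ≤ β := by
  refine (hlow _).trans ?_
  -- Move `P` to the left by commutation; A(1 − Q) = 0 then leaves only `B`.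
  have : (A + B) * (P * (1 - Q)) = P * B * (1 - Q) := by
    rw [← mul_assoc, hcomm, mul_assoc, add_mul, mul_sub A, hAQ]; noncomm_ring
  rw [this]
  calc ‖P * B * (1 - Q)‖ ≤ ‖P‖ * ‖B‖ * ‖1 - Q‖ := norm_mul₃_le
    _ ≤ 1 * ‖B‖ * 1 := by gcongr
    _ ≤ β := by linarith

/-- Since Q = AS, it suffices to bound (1 − P)A and pay ‖S‖ ≤ 1/m. That bound contains β‖(1 − P)Q‖
again, which is absorbed on the left and produces the factor m − β. -/
theorem norm_compl_mul_le {A B P Q S : R} {m β : ℝ} (hm : 0 < m)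
    (hAQ : A * Q = A) (hAS : A * S = Q)
    (hcomm : (A + B) * P = P * (A + B)) (nP' : ‖1 - P‖ ≤ 1) (nQ : ‖Q‖ ≤ 1) (hB : ‖B‖ ≤ β)
    (hS : m * ‖S‖ ≤ 1) (hup : ∀ M, ‖(A + B) * ((1 - P) * M)‖ ≤ β * ‖(1 - P) * M‖) :
    (m - β) * ‖(1 - P) * Q‖ ≤ β := by
  have h1 : (1 - P) * Q = (1 - P) * A * S := by rw [mul_assoc, hAS]
  have h2 : (1 - P) * A = (A + B) * ((1 - P) * Q) - (1 - P) * B * Q := by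
    have e : (A + B) * (1 - P) = (1 - P) * (A + B) := by
      rw [mul_sub, hcomm]; noncomm_ring
    rw [← mul_assoc, e]
    nth_rw 1 [← hAQ]
    noncomm_ring
  have h3 : ‖(1 - P) * A‖ ≤ β * ‖(1 - P) * Q‖ + β := by
    rw [h2]
    refine (norm_sub_le _ _).trans (add_le_add (hup _) ?_)
    calc ‖(1 - P) * B * Q‖ ≤ ‖1 - P‖ * ‖B‖ * ‖Q‖ := norm_mul₃_le
      _ ≤ 1 * ‖B‖ * 1 := by gcongr
      _ ≤ β := by linarith
  have h4 : m * ‖(1 - P) * Q‖ ≤ ‖(1 - P) * A‖ := by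
    calc m * ‖(1 - P) * Q‖ ≤ m * (‖(1 - P) * A‖ * ‖S‖) := by
          nth_rw 1 [h1]; gcongr; exact norm_mul_le _ _
      _ = ‖(1 - P) * A‖ * (m * ‖S‖) := by ring
      _ ≤ ‖(1 - P) * A‖ * 1 := by gcongr
      _ = _ := mul_one _
  linarith

theorem sub_eq_mul_compl_sub (P Q : R) : P - Q = P * (1 - Q) - (1 - P) * Q := by
  noncomm_ring

/-- Because (1 − Q)A = 0, commutation expresses (1 − Q)PA through W + G alone. Multiplying by `S`
turns PA into PQ, and PS = S − (1 − P)QS isolates the linear term; every remaining term is of second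
order. -/
theorem compl_mul_mul_sub_eq {A G P Q S W : R} (hQA : Q * A = A) (hAS : A * S = Q)
    (hQS : Q * S = S) (hcomm : (A + (W + G)) * P = P * (A + (W + G))) :
    (1 - Q) * P * Q - (1 - Q) * W * S =
      (1 - Q) * G * S - (1 - Q) * (W + G) * ((1 - P) * Q) * S - (1 - Q) * P * (W + G) * S := by
  have h0 : (1 - Q) * A = 0 := by rw [sub_mul, one_mul, hQA, sub_self]
  have h1 : (1 - Q) * P * A = (1 - Q) * (W + G) * P - (1 - Q) * P * (W + G) := by
    have e : (1 - Q) * ((A + (W + G)) * P) = (1 - Q) * (P * (A + (W + G))) := by rw [hcomm]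
    have e' : (1 - Q) * ((A + (W + G)) * P) = (1 - Q) * A * P + (1 - Q) * (W + G) * P := by
      noncomm_ring
    rw [e', h0, zero_mul, zero_add] at e
    rw [e]; noncomm_ring
  have h2 : (1 - Q) * P * Q = (1 - Q) * P * A * S := by rw [mul_assoc _ A, hAS]
  have h3 : (1 - P) * Q * S = S - P * S := by rw [mul_assoc, hQS]; noncomm_ring
  rw [h2, h1, mul_assoc _ ((1 - P) * Q) S, h3]
  noncomm_ring

/-- Second-order bound for the projector `P` commuting with `A + W + G`. -/
theorem norm_sub_sub_le [StarRing R] [NormedStarGroup R] {A G P Q S W : R} {m β γ x : ℝ}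
    (hm : 0 < m) (hPP : P * P = P) (hQA : Q * A = A) (hAS : A * S = Q)
    (hQQ : Q * Q = Q) (hQS : Q * S = S) (hcomm : (A + (W + G)) * P = P * (A + (W + G)))
    (sP : star P = P) (sQ : star Q = Q) (nQ' : ‖1 - Q‖ ≤ 1)
    (hB : ‖W + G‖ ≤ β) (hG : ‖G‖ ≤ γ) (hS : m * ‖S‖ ≤ 1)
    (hx : ‖P * (1 - Q)‖ ≤ x) (hx' : ‖(1 - P) * Q‖ ≤ x) :
    ‖P - Q - ((1 - Q) * W * S + star ((1 - Q) * W * S))‖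
      ≤ 2 * x ^ 2 + 2 * ((γ + 2 * β * x) / m) := by
  have x0 : 0 ≤ x := (norm_nonneg _).trans hx
  have β0 : 0 ≤ β := (norm_nonneg _).trans hB
  have γ0 : 0 ≤ γ := (norm_nonneg _).trans hG
  have hS' : ‖S‖ ≤ 1 / m := by rw [le_div_iff₀ hm]; linarith
  have sQ' : star (1 - Q) = 1 - Q := by simp [sQ]
  have sP' : star (1 - P) = 1 - P := by simp [sP]
  have hy : ‖(1 - Q) * P‖ ≤ x := by
    rw [← norm_star, star_mul, sQ', sP]; exact hx
  have hy' : ‖Q * (1 - P)‖ ≤ x := by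
    rw [← norm_star, star_mul, sQ, sP']; exact hx'
  have hPP' : (1 - P) * (1 - P) = 1 - P := by
    rw [sub_mul, mul_sub, mul_sub, hPP]; noncomm_ring
  have hZ : ‖(1 - Q) * P * Q - (1 - Q) * W * S‖ ≤ (γ + 2 * β * x) / m := by
    rw [compl_mul_mul_sub_eq hQA hAS hQS hcomm]
    have e1 : ‖(1 - Q) * G * S‖ ≤ 1 * γ * (1 / m) :=
      norm_mul₃_le.trans (by gcongr)
    have e2 : ‖(1 - Q) * (W + G) * ((1 - P) * Q) * S‖ ≤ 1 * β * x * (1 / m) := by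
      refine (norm_mul_le _ _).trans ?_
      gcongr
      exact norm_mul₃_le.trans (by gcongr)
    have e3 : ‖(1 - Q) * P * (W + G) * S‖ ≤ x * β * (1 / m) :=
      norm_mul₃_le.trans (by gcongr)
    calc _ ≤ 1 * γ * (1 / m) + 1 * β * x * (1 / m) + x * β * (1 / m) :=
          (norm_sub_le _ _).trans (add_le_add ((norm_sub_le _ _).trans (add_le_add e1 e2)) e3)
      _ = _ := by ring
  -- Block decomposition along `Q` and 1 − Q. Idempotency of `P` and 1 − P factors the diagonal
  -- blocks into two small terms each; the off-diagonal blocks are adjoint to each other.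
  have key : P - Q - ((1 - Q) * W * S + star ((1 - Q) * W * S)) =
      (1 - Q) * P * (P * (1 - Q)) - Q * (1 - P) * ((1 - P) * Q)
        + (((1 - Q) * P * Q - (1 - Q) * W * S)
          + star ((1 - Q) * P * Q - (1 - Q) * W * S)) := by
    have e1 : (1 - Q) * P * (P * (1 - Q)) = (1 - Q) * P * (1 - Q) := by
      rw [mul_assoc, ← mul_assoc P P, hPP, ← mul_assoc]
    have e2 : Q * (1 - P) * ((1 - P) * Q) = Q * (1 - P) * Q := by
      rw [mul_assoc, ← mul_assoc (1 - P) (1 - P), hPP', ← mul_assoc]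
    have e3 : star ((1 - Q) * P * Q) = Q * P * (1 - Q) := by
      rw [star_mul, star_mul, sQ', sQ, sP, mul_assoc]
    have e4 : Q * (1 - P) * Q = Q - Q * P * Q := by
      rw [mul_sub, sub_mul, mul_one, hQQ]
    rw [e1, e2, star_sub, e3, e4]
    noncomm_ring
  rw [key]
  calc _ ≤ (x * x + x * x) + ((γ + 2 * β * x) / m + (γ + 2 * β * x) / m) := by
        refine (norm_add_le _ _).trans (add_le_add ((norm_sub_le _ _).trans (add_le_add ?_ ?_))
          ((norm_add_le _ _).trans (add_le_add hZ ?_)))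
        · exact (norm_mul_le _ _).trans (by gcongr)
        · exact (norm_mul_le _ _).trans (by gcongr)
        · rw [norm_star]; exact hZ
    _ = _ := by ring

end NormedRing

/-! ### Matrices as operators, and projector matrices -/

variable {L K : ℕ}

theorem norm_toEuclideanLin_le (M : Matrix (Fin L) (Fin L) ℝ) (v : EuclideanSpace ℝ (Fin L)) :
    ‖Matrix.toEuclideanLin M v‖ ≤ ‖M‖ * ‖v‖ := by
  rw [Matrix.cstar_norm_def M]
  exact (Matrix.toEuclideanCLM (n := Fin L) (𝕜 := ℝ) M).le_opNorm v

theorem norm_le_of_forall {M : Matrix (Fin L) (Fin L) ℝ} {c : ℝ} (hc : 0 ≤ c)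
    (h : ∀ v, ‖Matrix.toEuclideanLin M v‖ ≤ c * ‖v‖) : ‖M‖ ≤ c := by
  rw [Matrix.cstar_norm_def M]
  exact ContinuousLinearMap.opNorm_le_bound _ hc h

theorem mul_norm_le_norm_of_forall {M N : Matrix (Fin L) (Fin L) ℝ} {c : ℝ} (hc : 0 ≤ c)
    (h : ∀ v, c * ‖Matrix.toEuclideanLin M v‖ ≤ ‖Matrix.toEuclideanLin N v‖) :
    c * ‖M‖ ≤ ‖N‖ := by
  have : ‖c • M‖ ≤ ‖N‖ := norm_le_of_forall (norm_nonneg _) fun v => by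
    rw [map_smul, LinearMap.smul_apply, norm_smul, Real.norm_of_nonneg hc]
    exact (h v).trans (norm_toEuclideanLin_le N v)
  rwa [norm_smul, Real.norm_of_nonneg hc] at this

theorem toEuclideanLin_mul_apply (M N : Matrix (Fin L) (Fin L) ℝ)
    (v : EuclideanSpace ℝ (Fin L)) :
    Matrix.toEuclideanLin (M * N) v = Matrix.toEuclideanLin M (Matrix.toEuclideanLin N v) := by
  have := map_mul (Matrix.toEuclideanCLM (n := Fin L) (𝕜 := ℝ)) M N
  exact congrArg (fun f => f v) this

theorem ext_of_toEuclideanLin {M N : Matrix (Fin L) (Fin L) ℝ}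
    (h : ∀ v, Matrix.toEuclideanLin M v = Matrix.toEuclideanLin N v) : M = N :=
  Matrix.toEuclideanLin.injective (LinearMap.ext h)

section ProjMatrix

variable (U : Submodule ℝ (EuclideanSpace ℝ (Fin L)))

theorem toEuclideanCLM_projMatrix :
    Matrix.toEuclideanCLM (n := Fin L) (𝕜 := ℝ) (projMatrix U) = U.starProjection :=
  StarAlgEquiv.apply_symm_apply _ _

theorem toEuclideanLin_projMatrix_apply (v : EuclideanSpace ℝ (Fin L)) :
    Matrix.toEuclideanLin (projMatrix U) v = U.starProjection v :=
  congrArg (fun f => f v) (toEuclideanCLM_projMatrix U)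

theorem one_sub_projMatrix : 1 - projMatrix U = projMatrix Uᗮ := by
  apply EquivLike.injective (Matrix.toEuclideanCLM (n := Fin L) (𝕜 := ℝ))
  rw [map_sub, map_one, toEuclideanCLM_projMatrix, toEuclideanCLM_projMatrix,
    Submodule.starProjection_orthogonal]
  rfl

theorem norm_projMatrix_le : ‖projMatrix U‖ ≤ 1 := by
  rw [Matrix.cstar_norm_def, toEuclideanCLM_projMatrix]
  exact U.starProjection_norm_le

theorem projMatrix_mul_self : projMatrix U * projMatrix U = projMatrix U := by
  apply EquivLike.injective (Matrix.toEuclideanCLM (n := Fin L) (𝕜 := ℝ))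
  rw [map_mul, toEuclideanCLM_projMatrix]
  exact U.isIdempotentElem_starProjection

theorem star_projMatrix : star (projMatrix U) = projMatrix U := by
  apply EquivLike.injective (Matrix.toEuclideanCLM (n := Fin L) (𝕜 := ℝ))
  rw [map_star, toEuclideanCLM_projMatrix]
  exact isSelfAdjoint_starProjection U

variable {U}

theorem toEuclideanLin_projMatrix_mul_mem (M : Matrix (Fin L) (Fin L) ℝ)
    (v : EuclideanSpace ℝ (Fin L)) : Matrix.toEuclideanLin (projMatrix U * M) v ∈ U := by
  rw [toEuclideanLin_mul_apply, toEuclideanLin_projMatrix_apply]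
  exact U.starProjection_apply_mem _

theorem projMatrix_mul_eq_self {M : Matrix (Fin L) (Fin L) ℝ}
    (h : ∀ v, Matrix.toEuclideanLin M v ∈ U) : projMatrix U * M = M :=
  ext_of_toEuclideanLin fun v => by
    rw [toEuclideanLin_mul_apply, toEuclideanLin_projMatrix_apply]
    exact Submodule.starProjection_eq_self_iff.mpr (h v)

/-- Invariance of `U` says ΠMΠ = MΠ for the projector Π; the adjoint of this identity is ΠMΠ = ΠM.
-/
theorem mul_projMatrix_comm {M : Matrix (Fin L) (Fin L) ℝ} (hM : star M = M)
    (h : ∀ u ∈ U, Matrix.toEuclideanLin M u ∈ U) : M * projMatrix U = projMatrix U * M := by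
  have h1 : projMatrix U * (M * projMatrix U) = M * projMatrix U :=
    projMatrix_mul_eq_self fun v => by
      rw [toEuclideanLin_mul_apply, toEuclideanLin_projMatrix_apply]
      exact h _ (U.starProjection_apply_mem _)
  have h2 := congrArg star h1
  rw [star_mul, star_mul, hM, star_projMatrix, mul_assoc, h1] at h2
  exact h2

end ProjMatrix

/-! ### Spectrum, kernel and pseudoinverse of the Gram matrix -/

section Gram

variable (H : Matrix (Fin L) (Fin K) ℝ)

theorem star_gram : star (gram H) = gram H := gram_isHermitian H

theorem norm_gram : ‖gram H‖ = ‖H‖ ^ 2 := by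
  have h := Matrix.l2_opNorm_conjTranspose_mul_self H.conjTranspose
  rw [Matrix.conjTranspose_conjTranspose, Matrix.l2_opNorm_conjTranspose, ← sq] at h
  exact h

theorem norm_transpose (M : Matrix (Fin L) (Fin K) ℝ) : ‖M.transpose‖ = ‖M‖ :=
  Matrix.l2_opNorm_conjTranspose M

theorem mem_ker_gram_iff (v : EuclideanSpace ℝ (Fin L)) :
    v ∈ Module.End.eigenspace (Matrix.toEuclideanLin (gram H)) 0
      ↔ Matrix.toEuclideanLin (gram H) v = 0 := by
  rw [Module.End.mem_eigenspace_iff, zero_smul]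

theorem gram_mul_kerProj : gram H * kerProj H = 0 := by
  refine ext_of_toEuclideanLin fun v => ?_
  rw [toEuclideanLin_mul_apply, kerProj, toEuclideanLin_projMatrix_apply, map_zero,
    LinearMap.zero_apply, ← mem_ker_gram_iff]
  exact Submodule.starProjection_apply_mem _ _

theorem star_kerProj : star (kerProj H) = kerProj H := star_projMatrix _

theorem kerProj_mul_gram : kerProj H * gram H = 0 := by
  have h := congrArg star (gram_mul_kerProj H)
  rwa [star_mul, star_gram, star_kerProj, star_zero] at h

theorem kerProj_mul_eq_self {M : Matrix (Fin L) (Fin L) ℝ} (h : gram H * M = 0) :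
    kerProj H * M = M :=
  projMatrix_mul_eq_self fun v => by
    rw [mem_ker_gram_iff, ← toEuclideanLin_mul_apply, h, map_zero, LinearMap.zero_apply]

/-- The Penrose equations give A(1 − AS) = 0, so the kernel projector fixes 1 − AS; as it also kills
`A`, it equals 1 − AS. -/
theorem gram_mul_gramPinv : gram H * gramPinv H = signalProj H := by
  have h : kerProj H * (1 - gram H * gramPinv H) = 1 - gram H * gramPinv H :=
    kerProj_mul_eq_self H (by
      rw [mul_sub, mul_one, sub_eq_zero]
      have h1 := (gramPinv_isMoorePenrose H).left_symm
      have h2 := congrArg Matrix.transpose (gramPinv_isMoorePenrose H).mul_mul_self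
      have h3 : (gram H).transpose = gram H := gram_isHermitian H
      rw [Matrix.transpose_mul, h1, h3] at h2
      exact h2.symm)
  rw [mul_sub, mul_one, ← mul_assoc, kerProj_mul_gram, zero_mul, sub_zero] at h
  rw [signalProj, h, sub_sub_cancel]

theorem signalProj_mul_gramPinv : signalProj H * gramPinv H = gramPinv H := by
  have h : kerProj H * (1 - gramPinv H * gram H) = 1 - gramPinv H * gram H :=
    kerProj_mul_eq_self H (by
      rw [mul_sub, mul_one, ← mul_assoc, (gramPinv_isMoorePenrose H).mul_mul_self, sub_self])
  have h' := congrArg star h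
  have hs : star (gramPinv H * gram H) = gramPinv H * gram H :=
    (gramPinv_isMoorePenrose H).right_symm
  rw [star_mul, star_sub, star_one, hs, star_kerProj, sub_mul, one_mul, mul_assoc,
    gram_mul_kerProj, mul_zero, sub_zero] at h'
  rw [signalProj, h', sub_sub_cancel, (gramPinv_isMoorePenrose H).self_mul_mul]

theorem star_gramPinv : star (gramPinv H) = gramPinv H := by
  have h : gramPinv H = cfc (fun x : ℝ => x⁻¹) (gram H) := ((gram_isHermitian H).cfc_eq _).symm
  rw [h]
  exact (cfc_predicate (fun x : ℝ => x⁻¹) (gram H) : IsSelfAdjoint _)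

theorem gram_mul_signalProj : gram H * signalProj H = gram H := by
  rw [signalProj, mul_sub, mul_one, gram_mul_kerProj, sub_zero]

theorem signalProj_mul_gram : signalProj H * gram H = gram H := by
  rw [signalProj, sub_mul, one_mul, kerProj_mul_gram, sub_zero]

theorem signalProj_eq_projMatrix : signalProj H =
    projMatrix (Module.End.eigenspace (Matrix.toEuclideanLin (gram H)) 0)ᗮ :=
  one_sub_projMatrix _

theorem finrank_ker_gram : H.rank +
    Module.finrank ℝ (Module.End.eigenspace (Matrix.toEuclideanLin (gram H)) 0) = L := by
  have h := LinearMap.finrank_range_add_finrank_ker (Matrix.toEuclideanLin (gram H))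
  have hr : Module.finrank ℝ (LinearMap.range (Matrix.toEuclideanLin (gram H))) = H.rank := by
    rw [← Matrix.rank_self_mul_transpose H, Matrix.toEuclideanLin_eq_toLin_orthonormal,
      ← Matrix.rank_eq_finrank_range_toLin]
    rfl
  rw [hr, finrank_euclideanSpace_fin] at h
  rwa [Module.End.eigenspace_zero]

theorem inner_gram_nonneg (v : EuclideanSpace ℝ (Fin L)) :
    0 ≤ inner ℝ v (Matrix.toEuclideanLin (gram H) v) := by
  have h : (gram H).PosSemidef := Matrix.posSemidef_self_mul_conjTranspose H
  exact (Matrix.isPositive_toEuclideanLin_iff.mpr h).re_inner_nonneg_right v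

theorem exists_eigenbasis : ∃ (b : OrthonormalBasis (Fin L) ℝ (EuclideanSpace ℝ (Fin L)))
    (ev : Fin L → ℝ), ∀ i, Matrix.toEuclideanLin (gram H) (b i) = ev i • b i := by
  have hs := Matrix.isSymmetric_toEuclideanLin_iff.mpr (gram_isHermitian H)
  have hn : Module.finrank ℝ (EuclideanSpace ℝ (Fin L)) = L := by simp
  exact ⟨hs.eigenvectorBasis hn, hs.eigenvalues hn, fun i => hs.apply_eigenvectorBasis hn i⟩

variable {H}

theorem eigenvalue_mem {b : OrthonormalBasis (Fin L) ℝ (EuclideanSpace ℝ (Fin L))}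
    {ev : Fin L → ℝ} (hb : ∀ i, Matrix.toEuclideanLin (gram H) (b i) = ev i • b i) (i : Fin L) :
    ev i ∈ eigenvalueSet (gram H) :=
  Module.End.hasEigenvalue_of_hasEigenvector
    ⟨Module.End.mem_eigenspace_iff.mpr (hb i), b.orthonormal.ne_zero i⟩

theorem eigenvalue_nonneg {b : OrthonormalBasis (Fin L) ℝ (EuclideanSpace ℝ (Fin L))}
    {ev : Fin L → ℝ} (hb : ∀ i, Matrix.toEuclideanLin (gram H) (b i) = ev i • b i) (i : Fin L) :
    0 ≤ ev i := by
  have h := inner_gram_nonneg H (b i)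
  rw [hb, inner_smul_right, real_inner_self_eq_norm_sq, b.norm_eq_one] at h
  simpa using h

theorem finite_eigenvalueSet (A : Matrix (Fin L) (Fin L) ℝ) : (eigenvalueSet A).Finite :=
  Module.End.finite_hasEigenvalue _

theorem le_muMax {μ : ℝ} (h : μ ∈ eigenvalueSet (gram H)) : μ ≤ muMax H :=
  le_csSup (finite_eigenvalueSet _).bddAbove h

theorem muMin_le {μ : ℝ} (h : μ ∈ eigenvalueSet (gram H)) (h0 : 0 < μ) : muMin H ≤ μ :=
  csInf_le ⟨0, fun _ hx => hx.2.le⟩ ⟨h, h0⟩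

theorem muMin_mem (hH : H ≠ 0) : muMin H ∈ eigenvalueSet (gram H) ∧ 0 < muMin H := by
  have hne : {μ | μ ∈ eigenvalueSet (gram H) ∧ 0 < μ}.Nonempty := by
    obtain ⟨b, ev, hb⟩ := exists_eigenbasis H
    by_contra hc
    have h0 : ∀ i, ev i = 0 := fun i => by
      by_contra hi
      exact hc ⟨ev i, eigenvalue_mem hb i, lt_of_le_of_ne (eigenvalue_nonneg hb i) (Ne.symm hi)⟩
    have : ‖gram H‖ ≤ 0 := norm_le_of_forall le_rfl fun v =>
      norm_apply_le_of_eigenbasis b hb le_rfl fun i _ => by rw [h0 i, abs_zero]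
    rw [norm_gram] at this
    exact hH (norm_eq_zero.mp (pow_eq_zero_iff two_ne_zero |>.mp (le_antisymm this (sq_nonneg _))))
  exact hne.csInf_mem ((finite_eigenvalueSet _).subset fun _ h => h.1)

theorem norm_sq_le_muMax (hH : H ≠ 0) : ‖H‖ ^ 2 ≤ muMax H := by
  obtain ⟨hm, hpos⟩ := muMin_mem hH
  obtain ⟨b, ev, hb⟩ := exists_eigenbasis H
  have hM : 0 ≤ muMax H := hpos.le.trans (le_muMax hm)
  rw [← norm_gram]
  exact norm_le_of_forall hM fun v => norm_apply_le_of_eigenbasis b hb hM fun i _ => by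
    rw [abs_of_nonneg (eigenvalue_nonneg hb i)]
    exact le_muMax (eigenvalue_mem hb i)

theorem muMin_le_eigenvalue {b : OrthonormalBasis (Fin L) ℝ (EuclideanSpace ℝ (Fin L))}
    {ev : Fin L → ℝ} (hb : ∀ i, Matrix.toEuclideanLin (gram H) (b i) = ev i • b i)
    {v : EuclideanSpace ℝ (Fin L)}
    (hv : v ∈ (Module.End.eigenspace (Matrix.toEuclideanLin (gram H)) 0)ᗮ) {i : Fin L}
    (hi : inner ℝ (b i) v ≠ 0) : muMin H ≤ ev i := by
  refine muMin_le (eigenvalue_mem hb i) (lt_of_le_of_ne (eigenvalue_nonneg hb i) fun h0 => ?_)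
  refine hi (hv _ ?_)
  rw [mem_ker_gram_iff, hb, ← h0, zero_smul]

/-- The range of `S` lies in the signal subspace, where `A` stretches by at least μ_min, while AS is
a projector. -/
theorem muMin_mul_norm_gramPinv_le (hH : H ≠ 0) : muMin H * ‖gramPinv H‖ ≤ 1 := by
  have hm := (muMin_mem hH).2.le
  obtain ⟨b, ev, hb⟩ := exists_eigenbasis H
  calc muMin H * ‖gramPinv H‖ ≤ ‖gram H * gramPinv H‖ := by
        refine mul_norm_le_norm_of_forall hm fun v => ?_
        rw [toEuclideanLin_mul_apply]
        refine le_norm_apply_of_eigenbasis b hb hm fun i hi => ?_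
        refine (muMin_le_eigenvalue hb ?_ hi).trans (le_abs_self _)
        rw [← signalProj_mul_gramPinv, signalProj_eq_projMatrix]
        exact toEuclideanLin_projMatrix_mul_mem _ _
    _ ≤ 1 := by
        rw [gram_mul_gramPinv, signalProj_eq_projMatrix]
        exact norm_projMatrix_le _

end Gram

/-! ### What Θ controls -/

section Theta

variable {H E : Matrix (Fin L) (Fin K) ℝ}

theorem norm_mul_norm_le_Theta_mul (hH : H ≠ 0) : ‖E‖ * ‖H‖ ≤ Theta H E * muMin H := by
  obtain ⟨hm, hpos⟩ := muMin_mem hH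
  have hM : 0 < muMax H := hpos.trans_le (le_muMax hm)
  have e : Theta H E * muMin H = ‖E‖ * √(muMax H) := by
    rw [Theta, nuMax, norm_gram, Real.sqrt_div (sq_nonneg _), Real.sqrt_sq (norm_nonneg _)]
    have := Real.mul_self_sqrt hM.le
    have h0 : √(muMax H) ≠ 0 := (Real.sqrt_pos.mpr hM).ne'
    field_simp
    linear_combination (-1) * ‖E‖ * this
  rw [e]
  gcongr
  exact Real.le_sqrt_of_sq_le (norm_sq_le_muMax hH)

theorem norm_sq_le_Theta_sq_mul (hH : H ≠ 0) : ‖E‖ ^ 2 ≤ Theta H E ^ 2 * muMin H := by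
  obtain ⟨hm, hpos⟩ := muMin_mem hH
  have hM : 0 < muMax H := hpos.trans_le (le_muMax hm)
  have e : Theta H E ^ 2 * muMin H = ‖E‖ ^ 2 * (muMax H / muMin H) := by
    rw [Theta, nuMax, norm_gram, mul_pow, Real.sq_sqrt (by positivity)]
    field_simp
  rw [e]
  refine le_mul_of_one_le_right (sq_nonneg _) ?_
  rw [one_le_div hpos]
  exact le_muMax hm

theorem Theta_nonneg (hH : H ≠ 0) : 0 ≤ Theta H E := by
  obtain ⟨hm, hpos⟩ := muMin_mem hH
  have hM : 0 < muMax H := hpos.trans_le (le_muMax hm)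
  rw [Theta]; positivity

end Theta

/-! ### Weyl-type eigenvalue bounds by dimension counting -/

section Weyl

variable {H : Matrix (Fin L) (Fin K) ℝ} {B : Matrix (Fin L) (Fin L) ℝ}
  {b : OrthonormalBasis (Fin L) ℝ (EuclideanSpace ℝ (Fin L))} {ev : Fin L → ℝ}

theorem abs_inner_toEuclideanLin_le (B : Matrix (Fin L) (Fin L) ℝ)
    (v : EuclideanSpace ℝ (Fin L)) :
    |inner ℝ v (Matrix.toEuclideanLin B v)| ≤ ‖B‖ * ‖v‖ ^ 2 := by
  refine (abs_real_inner_le_norm _ _).trans ?_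
  calc ‖v‖ * ‖Matrix.toEuclideanLin B v‖ ≤ ‖v‖ * (‖B‖ * ‖v‖) := by
        gcongr; exact norm_toEuclideanLin_le _ _
    _ = _ := by ring

/-- Weyl's inequality for the eigenvalues past the rank of the unperturbed matrix. -/
theorem eigenvalue_le_norm (hev : Antitone ev)
    (hb : ∀ i, Matrix.toEuclideanLin (gram H + B) (b i) = ev i • b i) {i : Fin L}
    (hi : H.rank ≤ i) : ev i ≤ ‖B‖ := by
  have hd := finrank_ker_gram H
  -- The first i + 1 eigenvectors and the kernel of dimension L − d must meet, since i ≥ d; there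
  -- the form of `gram H` vanishes.
  obtain ⟨v, hv, hv', hv0⟩ := exists_mem_mem_ne_zero
    (s := Submodule.span ℝ (b '' (Finset.Iic i : Finset (Fin L))))
    (t := Module.End.eigenspace (Matrix.toEuclideanLin (gram H)) 0) (by
      rw [finrank_span_image, Fin.card_Iic, finrank_euclideanSpace_fin]; omega)
  have h1 : ev i * ‖v‖ ^ 2 ≤ _ := le_inner_apply_of_eigenbasis b hb fun j hj =>
    hev (Finset.mem_Iic.mp (mem_of_inner_ne_zero b hv hj))
  rw [map_add, LinearMap.add_apply, (mem_ker_gram_iff H v).mp hv', zero_add] at h1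
  have h2 := (le_abs_self _).trans (abs_inner_toEuclideanLin_le B v)
  exact le_of_mul_le_mul_right (h1.trans h2) (by positivity)

/-- Weyl's inequality for the eigenvalues up to the rank of the unperturbed matrix. -/
theorem muMin_sub_norm_le_eigenvalue (hev : Antitone ev)
    (hb : ∀ i, Matrix.toEuclideanLin (gram H + B) (b i) = ev i • b i) {i : Fin L}
    (hi : (i : ℕ) < H.rank) : muMin H - ‖B‖ ≤ ev i := by
  have hd := finrank_ker_gram H
  have ho := Submodule.finrank_add_finrank_orthogonal
    (Module.End.eigenspace (Matrix.toEuclideanLin (gram H)) 0)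
  rw [finrank_euclideanSpace_fin] at ho
  -- The last L − i eigenvectors and the signal subspace of dimension d must meet, since i < d.
  obtain ⟨v, hv, hv', hv0⟩ := exists_mem_mem_ne_zero
    (s := Submodule.span ℝ (b '' (Finset.Ici i : Finset (Fin L))))
    (t := (Module.End.eigenspace (Matrix.toEuclideanLin (gram H)) 0)ᗮ) (by
      rw [finrank_span_image, Fin.card_Ici, finrank_euclideanSpace_fin]
      have := i.isLt
      omega)
  have h1 := inner_apply_le_of_eigenbasis b hb (c := ev i) (v := v) fun j hj =>
    hev (Finset.mem_Ici.mp (mem_of_inner_ne_zero b hv hj))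
  rw [map_add, LinearMap.add_apply, inner_add_right] at h1
  obtain ⟨b', ev', hb'⟩ := exists_eigenbasis H
  have h2 := le_inner_apply_of_eigenbasis b' hb' (v := v) fun j hj =>
    muMin_le_eigenvalue hb' hv' hj
  have h3 := neg_le_of_abs_le (abs_inner_toEuclideanLin_le B v)
  have h4 : (muMin H - ‖B‖) * ‖v‖ ^ 2 ≤ ev i * ‖v‖ ^ 2 := by linarith
  exact le_of_mul_le_mul_right h4 (by positivity)

end Weyl

/-! ### Explicit bounds for the perturbed projector -/

section Perturbation

variable {H E : Matrix (Fin L) (Fin K) ℝ} {δ : ℝ} {P : Matrix (Fin L) (Fin L) ℝ}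

theorem gram_add_smul (H E : Matrix (Fin L) (Fin K) ℝ) (δ : ℝ) :
    gram (H + δ • E) =
      gram H + (δ • (H * E.transpose + E * H.transpose) + δ ^ 2 • gram E) := by
  simp only [gram, Matrix.transpose_add, Matrix.transpose_smul,
    Matrix.add_mul, Matrix.mul_add, Matrix.smul_mul, Matrix.mul_smul, smul_add, smul_smul, sq]
  abel

theorem norm_perturbation_le (H E : Matrix (Fin L) (Fin K) ℝ) (δ : ℝ) :
    ‖δ • (H * E.transpose + E * H.transpose) + δ ^ 2 • gram E‖
      ≤ 2 * |δ| * (‖E‖ * ‖H‖) + δ ^ 2 * ‖E‖ ^ 2 := by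
  have h1 : ‖H * E.transpose‖ ≤ ‖H‖ * ‖E‖ := by
    rw [← norm_transpose E]; exact Matrix.l2_opNorm_mul _ _
  have h2 : ‖E * H.transpose‖ ≤ ‖E‖ * ‖H‖ := by
    rw [← norm_transpose H]; exact Matrix.l2_opNorm_mul _ _
  refine (norm_add_le _ _).trans (add_le_add ?_ ?_)
  · rw [norm_smul, Real.norm_eq_abs]
    calc |δ| * ‖H * E.transpose + E * H.transpose‖
        ≤ |δ| * (‖H‖ * ‖E‖ + ‖E‖ * ‖H‖) := by
          gcongr; exact (norm_add_le _ _).trans (add_le_add h1 h2)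
      _ = _ := by ring
  · rw [norm_smul, norm_gram, Real.norm_of_nonneg (sq_nonneg δ)]

theorem toEuclideanLin_mem_span {T : EuclideanSpace ℝ (Fin L) →ₗ[ℝ] EuclideanSpace ℝ (Fin L)}
    {b : OrthonormalBasis (Fin L) ℝ (EuclideanSpace ℝ (Fin L))} {ev : Fin L → ℝ}
    (hb : ∀ i, T (b i) = ev i • b i) (s : Set (Fin L)) :
    ∀ u ∈ Submodule.span ℝ (b '' s), T u ∈ Submodule.span ℝ (b '' s) := by
  have : Submodule.span ℝ (b '' s) ≤ (Submodule.span ℝ (b '' s)).comap T := by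
    rw [Submodule.span_le]
    rintro _ ⟨i, hi, rfl⟩
    rw [SetLike.mem_coe, Submodule.mem_comap, hb]
    exact Submodule.smul_mem _ _ (Submodule.subset_span ⟨i, hi, rfl⟩)
  exact this

/-- The two one-sided angles between the perturbed and the unperturbed signal subspaces. -/
theorem IsPerturbedProj.angle_le (hH : H ≠ 0) (hP : IsPerturbedProj H E δ P) {β : ℝ}
    (hβ : ‖δ • (H * E.transpose + E * H.transpose) + δ ^ 2 • gram E‖ ≤ β) (hβm : β ≤ muMin H) :
    (muMin H - β) * ‖P * (1 - signalProj H)‖ ≤ β ∧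
      (muMin H - β) * ‖(1 - P) * signalProj H‖ ≤ β := by
  obtain ⟨b, ev, hev, hb, rfl⟩ := hP
  have hb0 := hb
  have hβ0 : 0 ≤ β := (norm_nonneg _).trans hβ
  have hcomm := mul_projMatrix_comm (star_gram (H + δ • E))
    (toEuclideanLin_mem_span hb {i | (i : ℕ) < H.rank})
  rw [gram_add_smul] at hb hcomm
  set B := δ • (H * E.transpose + E * H.transpose) + δ ^ 2 • gram E with hBdef
  constructor
  · refine norm_mul_compl_le (gram_mul_signalProj H) hcomm (norm_projMatrix_le _) ?_ hβ
      fun M => mul_norm_le_norm_of_forall (sub_nonneg.mpr hβm) fun v => ?_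
    · rw [signalProj, sub_sub_cancel]; exact norm_projMatrix_le _
    · rw [toEuclideanLin_mul_apply (gram H + B)]
      refine le_norm_apply_of_eigenbasis b hb (sub_nonneg.mpr hβm) fun i hi => ?_
      have hi' := mem_of_inner_ne_zero b (toEuclideanLin_projMatrix_mul_mem M v) hi
      have := muMin_sub_norm_le_eigenvalue hev hb hi'
      exact le_trans (by linarith) (le_abs_self _)
  · refine norm_compl_mul_le (muMin_mem hH).2 (gram_mul_signalProj H) (gram_mul_gramPinv H) hcomm
      ?_ ?_ hβ (muMin_mul_norm_gramPinv_le hH) fun M => ?_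
    · rw [one_sub_projMatrix]; exact norm_projMatrix_le _
    · rw [signalProj_eq_projMatrix]; exact norm_projMatrix_le _
    · have h : ‖(gram H + B) * ((1 - projMatrix (Submodule.span ℝ
          (b '' {i | (i : ℕ) < H.rank}))) * M)‖ ≤ ‖β • ((1 - projMatrix (Submodule.span ℝ
          (b '' {i | (i : ℕ) < H.rank}))) * M)‖ := by
        rw [← one_mul ‖_ * _‖]
        refine mul_norm_le_norm_of_forall zero_le_one fun v => ?_
        rw [one_mul, toEuclideanLin_mul_apply (gram H + B), map_smul, LinearMap.smul_apply,
          norm_smul, Real.norm_of_nonneg hβ0]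
        refine norm_apply_le_of_eigenbasis b hb hβ0 fun i hi => ?_
        rw [one_sub_projMatrix] at hi
        have hi' := notMem_of_inner_ne_zero b (toEuclideanLin_projMatrix_mul_mem M v) hi
        -- A Gram matrix has no negative eigenvalues, so the one-sided Weyl bound controls the
        -- modulus.
        rw [abs_of_nonneg (eigenvalue_nonneg hb0 i)]
        exact (eigenvalue_le_norm hev hb (not_lt.mp hi')).trans hβ
      rwa [norm_smul, Real.norm_of_nonneg hβ0] at h

/-- Explicit first- and second-order bounds for the perturbed projector. -/
theorem IsPerturbedProj.norm_sub_le (hH : H ≠ 0) (hP : IsPerturbedProj H E δ P)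
    (ht : |δ| * Theta H E ≤ 1 / 20) :
    ‖P - signalProj H‖ ≤ 5 * (|δ| * Theta H E) ∧
      ‖P - signalProj H - δ • linTerm H E‖ ≤ 35 * (|δ| * Theta H E) ^ 2 := by
  have hm := (muMin_mem hH).2
  have hΘ : 0 ≤ Theta H E := Theta_nonneg hH
  have h1 := norm_mul_norm_le_Theta_mul (E := E) hH
  have h2 := norm_sq_le_Theta_sq_mul (E := E) hH
  set m := muMin H
  set t := |δ| * Theta H E with htdef
  have ht0 : 0 ≤ t := by positivity
  have hγ : δ ^ 2 * ‖E‖ ^ 2 ≤ t ^ 2 * m := by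
    calc δ ^ 2 * ‖E‖ ^ 2 ≤ δ ^ 2 * (Theta H E ^ 2 * m) := by gcongr
      _ = t ^ 2 * m := by rw [htdef, mul_pow, sq_abs]; ring
  -- 41/20 = 2 + 1/20: twice the cross term, and t² ≤ t/20 for the quadratic one.
  have hβ : ‖δ • (H * E.transpose + E * H.transpose) + δ ^ 2 • gram E‖ ≤ 41 / 20 * t * m := by
    refine (norm_perturbation_le H E δ).trans ?_
    have h3 : 2 * |δ| * (‖E‖ * ‖H‖) ≤ 2 * t * m := by
      calc 2 * |δ| * (‖E‖ * ‖H‖) ≤ 2 * |δ| * (Theta H E * m) := by gcongr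
        _ = 2 * t * m := by rw [htdef]; ring
    have h4 : t ^ 2 * m ≤ 1 / 20 * t * m := by
      rw [sq]; gcongr
    linarith
  have htm : t * m ≤ 1 / 20 * m := by gcongr
  obtain ⟨hx, hy⟩ := hP.angle_le hH hβ (by linarith)
  have bound : ∀ x : ℝ, 0 ≤ x → (m - 41 / 20 * t * m) * x ≤ 41 / 20 * t * m → x ≤ 5 / 2 * t := by
    intro x hx0 hx
    -- 1 − (41/20)(1/20) exceeds 41/50, a value chosen so that (41/20)/(41/50) = 5/2.
    have h5 : 41 / 50 * m * x ≤ 41 / 20 * t * m := by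
      refine le_trans ?_ hx
      gcongr
      linarith
    have h6 : (41 / 50 * m) * x ≤ (41 / 50 * m) * (5 / 2 * t) := by linarith
    exact le_of_mul_le_mul_left h6 (by positivity)
  replace hx := bound _ (norm_nonneg _) hx
  replace hy := bound _ (norm_nonneg _) hy
  constructor
  · rw [sub_eq_mul_compl_sub]
    refine (_root_.norm_sub_le _ _).trans ?_
    linarith
  · obtain ⟨b, ev, hev, hb, rfl⟩ := hP
    have hcomm := mul_projMatrix_comm (star_gram (H + δ • E))
      (toEuclideanLin_mem_span hb {i | (i : ℕ) < H.rank})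
    rw [gram_add_smul] at hcomm
    have sQ : star (signalProj H) = signalProj H := by
      rw [signalProj_eq_projMatrix]; exact star_projMatrix _
    have hQQ : signalProj H * signalProj H = signalProj H := by
      rw [signalProj_eq_projMatrix]; exact projMatrix_mul_self _
    have hQ' : 1 - signalProj H = kerProj H := sub_sub_cancel _ _
    have nQ' : ‖1 - signalProj H‖ ≤ 1 := by
      rw [hQ']; exact norm_projMatrix_le _
    have hG : ‖δ ^ 2 • gram E‖ ≤ t ^ 2 * m := by
      rw [norm_smul, norm_gram, Real.norm_of_nonneg (sq_nonneg δ)]; exact hγ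
    have hlin : δ • linTerm H E =
        (1 - signalProj H) * (δ • (H * E.transpose + E * H.transpose)) * gramPinv H
          + star ((1 - signalProj H) * (δ • (H * E.transpose + E * H.transpose))
            * gramPinv H) := by
      have hA : star (H * E.transpose + E * H.transpose) = H * E.transpose + E * H.transpose := by
        change (H * E.transpose + E * H.transpose).transpose = _
        rw [Matrix.transpose_add, Matrix.transpose_mul, Matrix.transpose_mul,
          Matrix.transpose_transpose, Matrix.transpose_transpose, add_comm]
      rw [hQ', star_mul, star_mul, star_smul, star_trivial δ, hA, star_kerProj, star_gramPinv,
        linTerm, smul_add, mul_smul_comm, smul_mul_assoc, smul_mul_assoc, mul_smul_comm,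
        mul_assoc (gramPinv H)]
    rw [hlin]
    refine (norm_sub_sub_le hm (projMatrix_mul_self _) (signalProj_mul_gram H)
      (gram_mul_gramPinv H) hQQ (signalProj_mul_gramPinv H) hcomm (star_projMatrix _) sQ nQ' hβ hG
      (muMin_mul_norm_gramPinv_le hH) hx hy).trans (le_of_eq ?_)
    -- With x = (5/2)t, β = (41/20)tm and γ = t²m: 2x² + 2(γ + 2βx)/m = (12.5 + 22.5)t² = 35t².
    field_simp
    ring

end Perturbation

/-- A crude value suffices: 5 ≤ 8C needs C ≥ 5/8, and 35 ≤ 2(32C + 1) needs only C ≥ 33/64. -/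
theorem le_exp_div_sqrt_pi : 13 / 20 ≤ Real.exp (1 / 6) / √Real.pi := by
  have h1 : √Real.pi ≤ 1.775 := by
    rw [Real.sqrt_le_left (by norm_num)]
    exact Real.pi_lt_d2.le.trans (by norm_num)
  have h2 := Real.add_one_le_exp (1 / 6)
  rw [le_div_iff₀ (Real.sqrt_pos.mpr Real.pi_pos)]
  linarith

end SignalSubspace

end

theorem proposition2 (L K : ℕ → ℕ)
    (H E : ∀ N, Matrix (Fin (L N)) (Fin (K N)) ℝ)
    (hH : ∀ᶠ N in atTop, H N ≠ 0) (hE : ∀ᶠ N in atTop, E N ≠ 0)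
    (hrank : ∀ᶠ N in atTop, (H N).rank < min (L N) (K N))
    (hTheta : Tendsto (fun N => SignalSubspace.Theta (H N) (E N)) atTop (𝓝 0))
    (C : ℝ) (hC : C = Real.exp (1 / 6) / √Real.pi)
    (δ : ℝ) (P : ∀ N, Matrix (Fin (L N)) (Fin (L N)) ℝ)
    (hP : ∀ᶠ N in atTop, SignalSubspace.IsPerturbedProj (H N) (E N) δ (P N)) :
    limsup (fun N => (((SignalSubspace.Theta (H N) (E N))⁻¹ *
        ‖P N - SignalSubspace.signalProj (H N)‖ : ℝ) : EReal)) atTop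
      ≤ ((8 * C * |δ| : ℝ) : EReal) ∧
    limsup (fun N => (((SignalSubspace.Theta (H N) (E N))⁻¹ ^ 2 *
        ‖P N - SignalSubspace.signalProj (H N) - δ • SignalSubspace.linTerm (H N) (E N)‖ : ℝ) :
          EReal)) atTop
      ≤ ((2 * (32 * C + 1) * δ ^ 2 : ℝ) : EReal) := by
  have hlim : Tendsto (fun N => |δ| * SignalSubspace.Theta (H N) (E N)) atTop (𝓝 0) := by
    simpa using hTheta.const_mul |δ|
  have hsmall : ∀ᶠ N in atTop, |δ| * SignalSubspace.Theta (H N) (E N) ≤ 1 / 20 :=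
    hlim.eventually_le_const (by norm_num)
  have hC' : 13 / 20 ≤ C := hC ▸ SignalSubspace.le_exp_div_sqrt_pi
  -- An inequality, so that Θ = 0 is covered by the convention 0⁻¹ = 0.
  have hinv : ∀ x : ℝ, x⁻¹ * x ≤ 1 := fun x => by
    by_cases hx : x = 0
    · simp [hx]
    · rw [inv_mul_cancel₀ hx]
  constructor
  · refine limsup_le_of_le (h := ?_)
    filter_upwards [hH, hP, hsmall] with N hHN hPN hN
    have hΘ := SignalSubspace.Theta_nonneg (E := E N) hHN
    refine EReal.coe_le_coe_iff.mpr ?_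
    calc (SignalSubspace.Theta (H N) (E N))⁻¹ * ‖P N - SignalSubspace.signalProj (H N)‖
        ≤ (SignalSubspace.Theta (H N) (E N))⁻¹ *
          (5 * (|δ| * SignalSubspace.Theta (H N) (E N))) := by
          gcongr; exact (hPN.norm_sub_le hHN hN).1
      _ = 5 * |δ| * ((SignalSubspace.Theta (H N) (E N))⁻¹ *
          SignalSubspace.Theta (H N) (E N)) := by ring
      _ ≤ 5 * |δ| * 1 := by gcongr; exact hinv _
      _ ≤ 8 * C * |δ| := by rw [mul_one]; gcongr; linarith
  · refine limsup_le_of_le (h := ?_)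
    filter_upwards [hH, hP, hsmall] with N hHN hPN hN
    have hΘ := SignalSubspace.Theta_nonneg (E := E N) hHN
    refine EReal.coe_le_coe_iff.mpr ?_
    calc (SignalSubspace.Theta (H N) (E N))⁻¹ ^ 2 *
          ‖P N - SignalSubspace.signalProj (H N) - δ • SignalSubspace.linTerm (H N) (E N)‖
        ≤ (SignalSubspace.Theta (H N) (E N))⁻¹ ^ 2 *
          (35 * (|δ| * SignalSubspace.Theta (H N) (E N)) ^ 2) := by
          gcongr; exact (hPN.norm_sub_le hHN hN).2
      _ = 35 * δ ^ 2 * ((SignalSubspace.Theta (H N) (E N))⁻¹ *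
          SignalSubspace.Theta (H N) (E N)) ^ 2 := by rw [mul_pow |δ|, sq_abs]; ring
      _ ≤ 35 * δ ^ 2 * 1 ^ 2 := by gcongr; exact hinv _
      _ ≤ 2 * (32 * C + 1) * δ ^ 2 := by
          rw [one_pow, mul_one]; gcongr; linarith
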